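/- All graphs are finite and simple (no loops, no multiple edges). A cycle in a graph is a subgraph isomorphic to an $n$-gon with $n\ge 3$; it is chordless if it is an induced subgraph. An orientation of a graph chooses a direction for each edge; it is cyclic if every chordless cycle becomes a directed cycle. A graph is cyclically orientable if it has a cyclic orientation. Call two edges equivalent if they are equal or lie on a common cycle; the two-connected components of a graph are the connected induced subgraphs whose edge sets are the equivalence classes. A graph is two-connected if it is connected, has at least one edge, and all its edges are equivalent (so a single edge is two-connected and a single vertex is not). Let $G$ be a graph. (1) $G$ is cyclically orientable if and only if all of its two-connected components are. (2) Suppose that $G$ is two-connected. Then $G$ is cyclically orientable if and only if it is a cycle, or a single edge, or there are subgraphs $G'$ and $C$ of $G$ with $G=G'\cup C$ such that $G'$ is cyclically orientable, $C$ is a cycle, and $G'\cap C$ consists of exactly one edge and its two endpoints. (3) If $G=G'\cup C$ for any subgraphs $G'$ and $C$ such that $C$ is a cycle and $G'\cap C$ consists of exactly one edge and its two endpoints, then $G$ is cyclically orientable if and only if $G'$ is. -/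

import Mathlib

namespace CyclicOrientation

/-- An orientation of a graph: each edge gets exactly one of its two directions;
`arc u v` says that the edge `{u, v}` is directed from `u` to `v`. -/
structure GraphOrientation {V : Type*} (G : SimpleGraph V) where
  /-- the directed edges -/
  arc : V → V → Prop
  adj_of_arc : ∀ {u v : V}, arc u v → G.Adj u v
  arc_or_arc : ∀ {u v : V}, G.Adj u v → arc u v ∨ arc v u
  asymm : ∀ {u v : V}, arc u v → ¬ arc v u

/-- An orientation is cyclic if every chordless cycle `c` of the graph is cyclically oriented:
all edges of `c` point in the direction in which `c` traverses them, or all point the other way. -/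
def GraphOrientation.IsCyclic {V : Type*} {G : SimpleGraph V} (o : GraphOrientation G) : Prop :=
  ∀ (u : V) (c : G.Walk u u), c.IsCycle → c.IsChordless →
    (∀ d ∈ c.darts, o.arc d.fst d.snd) ∨ (∀ d ∈ c.darts, o.arc d.snd d.fst)

/-- A graph is cyclically orientable if it has a cyclic orientation. -/
def CyclicallyOrientable {V : Type*} (G : SimpleGraph V) : Prop :=
  ∃ o : GraphOrientation G, o.IsCyclic

/-- A subgraph which is a cycle (of length at least three, the graphs being simple). -/
def IsCycleSubgraph {V : Type*} {G : SimpleGraph V} (C : G.Subgraph) : Prop :=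
  ∃ (u : V) (c : G.Walk u u), c.IsCycle ∧ c.toSubgraph = C

/-- The relation on edges whose classes are the edge sets of the two-connected components:
two edges are related if they are equal or lie on a common cycle. -/
def EdgeRel {V : Type*} (G : SimpleGraph V) (e f : Sym2 V) : Prop :=
  e = f ∨ ∃ (u : V) (c : G.Walk u u), c.IsCycle ∧ e ∈ c.edges ∧ f ∈ c.edges

/-- A two-connected component: a connected induced subgraph whose edge set is a class
of `EdgeRel`. -/
def IsTwoConnectedComponent {V : Type*} (G : SimpleGraph V) (B : G.Subgraph) : Prop :=
  B.Connected ∧ B.IsInduced ∧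
    ∃ e ∈ G.edgeSet, B.edgeSet = {f | f ∈ G.edgeSet ∧ EdgeRel G e f}

/-- A graph is two-connected if it is connected, has an edge, and any two of its edges are
related, i.e. if the whole graph is a two-connected component of itself.
A single edge is two-connected; a single vertex is not. -/
def IsTwoConnected {V : Type*} (G : SimpleGraph V) : Prop :=
  G.Connected ∧ G.edgeSet.Nonempty ∧ ∀ e ∈ G.edgeSet, ∀ f ∈ G.edgeSet, EdgeRel G e f

/-- The graph is a cycle. -/
def IsCycleGraph {V : Type*} (G : SimpleGraph V) : Prop :=
  IsCycleSubgraph (⊤ : G.Subgraph)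

/-- The graph is a single edge. -/
def IsSingleEdge {V : Type*} (G : SimpleGraph V) : Prop :=
  ∃ (v w : V) (h : G.Adj v w), (⊤ : G.Subgraph) = G.subgraphOfAdj h

/-- `G = G' ∪ C`, where `C` is a cycle and the subgraphs `G'` and `C` meet along a single edge:
their intersection consists of one edge and its two endpoints. -/
def IsCycleGluing {V : Type*} (G : SimpleGraph V) (G' C : G.Subgraph) : Prop :=
  IsCycleSubgraph C ∧ G' ⊔ C = ⊤ ∧ ∃ (v w : V) (h : G.Adj v w), G' ⊓ C = G.subgraphOfAdj h

end CyclicOrientation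

/-!
A chordless cycle of an induced subgraph is chordless in the whole graph, so cyclic orientability
passes to induced subgraphs. The converses rest on locating chordless cycles. A cycle lies in a
single two-connected component, and a chordless cycle of a gluing lies on one side, since otherwise
the shared edge would be a chord; hence cyclic orientations of the pieces can be combined.

For the decomposition of a two-connected graph, choose a maximal proper vertex set `S` that no
vertex separates, and a shortest ear of `S`; by maximality the ear exhausts the complement of `S`.
If `a` and `b` are neighbours of `x` joined by a walk that avoids `x` and all its other neighbours,
then a cyclic orientation directs exactly one of the edges `xa` and `xb` away from `x`, so no three
neighbours of `x` are joined pairwise in this way. This forces the ends of the ear to be adjacent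
and excludes further edges between `S` and the ear.
-/

namespace CyclicOrientation

open SimpleGraph

variable {V : Type*} {G : SimpleGraph V}

section Walks

theorem isChordless_cons {u v w : V} {p : G.Walk v w} (hp : p.IsChordless) (h : G.Adj u v)
    (hu : ∀ z ∈ p.support, G.Adj u z → z = v) : (Walk.cons h p).IsChordless := by
  rw [Walk.isChordless_iff_forall_mem_edges]
  intro a b ha hb hab
  simp only [Walk.support_cons, List.mem_cons, Walk.edges_cons] at ha hb ⊢
  rcases ha with rfl | ha <;> rcases hb with rfl | hb
  · exact (hab.ne rfl).elim
  · exact .inl (by rw [hu b hb hab])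
  · exact .inl (by rw [hu a ha hab.symm, Sym2.eq_swap])
  · exact .inr (hp.mem_edges ha hb hab)

theorem isPath_of_forall_length_le {u v : V} {p : G.Walk u v}
    (h : ∀ q : G.Walk u v, q.support ⊆ p.support → p.length ≤ q.length) : p.IsPath := by
  classical
  rw [← p.bypass_eq_self_of_length_le_length_bypass (h _ p.support_bypass_subset_support)]
  exact p.bypass_isPath

theorem isChordless_of_forall_length_le {u v : V} {p : G.Walk u v}
    (h : ∀ q : G.Walk u v, q.support ⊆ p.support → p.length ≤ q.length) : p.IsChordless := by
  classical
  induction p with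
  | nil =>
    rw [Walk.isChordless_iff_forall_mem_edges]
    intro a b ha hb hab
    simp only [Walk.support_nil, List.mem_singleton] at ha hb
    exact (hab.ne (ha.trans hb.symm)).elim
  | @cons u x v hux p ih =>
    have hmin : ∀ {b} (_ : G.Adj u b) (q : G.Walk b v), q.support ⊆ p.support →
        p.length ≤ q.length := fun hub q hq => by
      simpa using h (Walk.cons hub q) (by simpa using List.cons_subset_cons _ hq)
    refine isChordless_cons (ih fun q hq => hmin hux q hq) hux fun b hb hub => ?_
    by_contra hbx
    exact (hmin hub _ (p.support_dropUntil_subset_support hb)).not_gt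
      (Walk.length_dropUntil_lt_length hb hbx)

theorem exists_isChordless_path_to {A : Set V} {R : V → Prop} {u v : V} (w : G.Walk u v)
    (hA : ∀ z ∈ w.support, z ∈ A) (hR : R v) :
    ∃ (v' : V) (p : G.Walk u v'), p.IsPath ∧ p.IsChordless ∧ (∀ z ∈ p.support, z ∈ A) ∧
      R v' ∧ ∀ z ∈ p.support, R z → z = v' := by
  classical
  let L : Set ℕ := {n | ∃ (v' : V) (p : G.Walk u v'), (∀ z ∈ p.support, z ∈ A) ∧ R v' ∧
    p.length = n}
  obtain ⟨v', p, hpA, hpR, hpn⟩ := Nat.sInf_mem (s := L) ⟨_, v, w, hA, hR, rfl⟩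
  have hmin : ∀ {x : V} (q : G.Walk u x), q.support ⊆ p.support → R x → p.length ≤ q.length :=
    fun q hq hx => hpn ▸ Nat.sInf_le ⟨_, q, fun z hz => hpA z (hq hz), hx, rfl⟩
  refine ⟨v', p, isPath_of_forall_length_le fun q hq => hmin q hq hpR,
    isChordless_of_forall_length_le fun q hq => hmin q hq hpR, hpA, hpR, fun z hz hRz => ?_⟩
  by_contra hne
  exact (hmin _ (p.support_takeUntil_subset_support hz) hRz).not_gt
    (Walk.length_takeUntil_lt_length hz hne)

theorem exists_isChordless_path {A : Set V} {u v : V} (w : G.Walk u v)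
    (hA : ∀ z ∈ w.support, z ∈ A) :
    ∃ p : G.Walk u v, p.IsPath ∧ p.IsChordless ∧ ∀ z ∈ p.support, z ∈ A := by
  obtain ⟨_, p, hp, cp, hpA, rfl, -⟩ := exists_isChordless_path_to (R := (· = v)) w hA rfl
  exact ⟨p, hp, cp, hpA⟩

theorem isChordless_map_iff {W : Type*} {H : SimpleGraph W} (f : G ↪g H) {u v : V}
    {p : G.Walk u v} : (p.map f.toHom).IsChordless ↔ p.IsChordless := by
  have hedge : ∀ a b, s(f a, f b) ∈ p.edges.map (Sym2.map f) ↔ s(a, b) ∈ p.edges := fun a b =>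
    List.mem_map_of_injective (a := s(a, b)) (Sym2.map.injective f.injective)
  simp only [Walk.isChordless_iff_forall_mem_edges, Walk.support_map, Walk.edges_map]
  constructor
  · intro h a b ha hb hab
    exact (hedge a b).1 (h (List.mem_map_of_mem ha) (List.mem_map_of_mem hb)
      (f.map_adj_iff.2 hab))
  · intro h a b ha hb hab
    obtain ⟨a, ha', rfl⟩ := List.mem_map.1 ha
    obtain ⟨b, hb', rfl⟩ := List.mem_map.1 hb
    exact (hedge a b).2 (h ha' hb' (f.map_adj_iff.1 hab))

end Walks

section Cycles

variable {u v u' v' : V} {p : G.Walk u v} {q : G.Walk v' u'}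

theorem isCycle_cons_append_cons (hp : p.IsPath) (hq : q.IsPath)
    (hd : ∀ z ∈ p.support, z ∉ q.support) (h : G.Adj v v') (h' : G.Adj u' u)
    (hne : u ≠ v ∨ u' ≠ v') : (Walk.cons h' (p.append (Walk.cons h q))).IsCycle := by
  rw [Walk.cons_isCycle_iff]
  constructor
  · rw [Walk.isPath_def, Walk.support_append, Walk.support_cons, List.tail_cons,
      List.nodup_append']
    exact ⟨hp.support_nodup, hq.support_nodup, hd⟩
  · simp only [Walk.edges_append, Walk.edges_cons, List.mem_append, List.mem_cons, not_or]
    refine ⟨fun hm => ?_, fun hm => ?_, fun hm => ?_⟩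
    · exact hd _ (p.fst_mem_support_of_mem_edges hm) q.end_mem_support
    · rcases Sym2.eq_iff.1 hm with ⟨rfl, rfl⟩ | ⟨rfl, rfl⟩
      · exact hd _ p.start_mem_support q.start_mem_support
      · simp at hne
    · exact hd _ p.start_mem_support (q.snd_mem_support_of_mem_edges hm)

theorem isChordless_cons_append_cons (cp : p.IsChordless) (cq : q.IsChordless)
    (h : G.Adj v v') (h' : G.Adj u' u)
    (hpq : ∀ a ∈ p.support, ∀ b ∈ q.support, G.Adj a b → (a = v ∧ b = v') ∨ (a = u ∧ b = u')) :
    (Walk.cons h' (p.append (Walk.cons h q))).IsChordless := by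
  have hsupp : ∀ z ∈ (Walk.cons h' (p.append (Walk.cons h q))).support,
      z ∈ p.support ∨ z ∈ q.support := by
    intro z
    simp only [Walk.support_cons, List.mem_cons, Walk.mem_support_append_iff]
    rintro (rfl | hz | rfl | hz)
    exacts [.inr q.end_mem_support, .inl hz, .inl p.end_mem_support, .inr hz]
  rw [Walk.isChordless_iff_forall_mem_edges]
  intro a b ha hb hadj
  simp only [Walk.edges_cons, Walk.edges_append, List.mem_append, List.mem_cons]
  rcases hsupp a ha with ha | ha <;> rcases hsupp b hb with hb | hb
  · exact .inr (.inl (cp.mem_edges ha hb hadj))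
  · rcases hpq a ha b hb hadj with ⟨rfl, rfl⟩ | ⟨rfl, rfl⟩
    · exact .inr (.inr (.inl rfl))
    · exact .inl Sym2.eq_swap
  · rcases hpq b hb a ha hadj.symm with ⟨rfl, rfl⟩ | ⟨rfl, rfl⟩
    · exact .inr (.inr (.inl Sym2.eq_swap))
    · exact .inl rfl
  · exact .inr (.inr (.inr (cq.mem_edges ha hb hadj)))

theorem exists_isCycle_cons {c : G.Walk u u} (hc : c.IsCycle) {x y : V} (h : s(x, y) ∈ c.edges) :
    ∃ (hxy : G.Adj x y) (p : G.Walk y x),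
      (Walk.cons hxy p).IsCycle ∧ (Walk.cons hxy p).toSubgraph = c.toSubgraph := by
  classical
  have of_snd : ∀ d : G.Walk x x, d.IsCycle → d.toSubgraph = c.toSubgraph → y = d.snd →
      ∃ (hxy : G.Adj x y) (p : G.Walk y x),
        (Walk.cons hxy p).IsCycle ∧ (Walk.cons hxy p).toSubgraph = c.toSubgraph := by
    rintro d hd hdc rfl
    refine ⟨d.adj_snd hd.not_nil, d.tail, ?_⟩
    rw [d.cons_tail_eq hd.not_nil]
    exact ⟨hd, hdc⟩
  have hx : x ∈ c.support := c.fst_mem_support_of_mem_edges h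
  have hd : (c.rotate x hx).IsCycle := hc.rotate hx
  have hdc : (c.rotate x hx).toSubgraph = c.toSubgraph := c.toSubgraph_rotate hx
  have hy : y ∈ (c.rotate x hx).toSubgraph.neighborSet x := by
    rwa [hdc, Subgraph.mem_neighborSet, Walk.adj_toSubgraph_iff_mem_edges]
  rw [hd.neighborSet_toSubgraph_endpoint] at hy
  rcases hy with hy | hy
  · exact of_snd _ hd hdc hy
  · exact of_snd _ hd.reverse (by rw [Walk.toSubgraph_reverse, hdc]) (by rw [Walk.snd_reverse, hy])

theorem exists_mem_support_ne_ne {c : G.Walk u u} (hc : c.IsCycle) (x y : V) :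
    ∃ z ∈ c.support, z ≠ x ∧ z ≠ y := by
  by_contra! h
  have hsub : c.support.tail ⊆ [x, y] := fun z hz => by
    simpa [or_iff_not_imp_left] using h z (List.mem_of_mem_tail hz)
  have hlen := (List.subperm_of_subset hc.support_nodup hsub).length_le
  simp only [List.length_tail, Walk.length_support, List.length_cons, List.length_nil] at hlen
  have := hc.three_le_length
  omega

theorem eq_or_eq_of_mem_takeUntil_of_mem_dropUntil [DecidableEq V] {c : G.Walk u u}
    (hc : c.IsCycle) {s : V} (hs : s ∈ c.support) {z : V} (hz : z ∈ (c.takeUntil s hs).support)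
    (hz' : z ∈ (c.dropUntil s hs).support) : z = u ∨ z = s := by
  by_contra! hne
  have hnd := hc.support_nodup
  rw [← c.take_spec hs, Walk.tail_support_append, List.nodup_append'] at hnd
  have mem_tail : ∀ {a b : V} {p : G.Walk a b}, z ∈ p.support → z ≠ a → z ∈ p.support.tail :=
    fun h h' => ((Walk.mem_support_iff _).1 h).resolve_left h'
  exact hnd.2.2 (mem_tail hz hne.1) (mem_tail hz' hne.2)

/-- The two arcs of the cycle between a vertex of `X` and one outside `X ∪ {x, y}` would each pass
through one of `x` and `y`, and then the edge between these is a chord. -/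
theorem support_subset_of_isChordless {X : Set V} {x y : V} (hxy : G.Adj x y) (hx : x ∉ X)
    (hy : y ∉ X) (hX : ∀ a ∈ X, ∀ b, G.Adj a b → b ∈ X ∨ b = x ∨ b = y) {c : G.Walk u u}
    (hc : c.IsCycle) (cc : c.IsChordless) (hcX : ∃ b ∈ c.support, b ∈ X) :
    ∀ s ∈ c.support, s ∈ X ∨ s = x ∨ s = y := by
  classical
  obtain ⟨b, hb, hbX⟩ := hcX
  intro s hs
  by_contra! hsX
  have hd : (c.rotate b hb).IsCycle := hc.rotate hb
  have hsd : s ∈ (c.rotate b hb).support := (c.mem_support_rotate_iff b hb).2 hs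
  set p := (c.rotate b hb).takeUntil s hsd
  set q := (c.rotate b hb).dropUntil s hsd
  have hpq : ∀ z ∈ p.support, z ∈ q.support → z ≠ x ∧ z ≠ y := by
    intro z hzp hzq
    rcases eq_or_eq_of_mem_takeUntil_of_mem_dropUntil hd hsd hzp hzq with rfl | rfl
    · exact ⟨ne_of_mem_of_not_mem hbX hx, ne_of_mem_of_not_mem hbX hy⟩
    · exact hsX.2
  have meets : ∀ r : G.Walk b s, x ∈ r.support ∨ y ∈ r.support := by
    intro r
    obtain ⟨d, hdr, hd₁, hd₂⟩ := r.exists_boundary_dart X hbX hsX.1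
    have := r.dart_snd_mem_support_of_mem_darts hdr
    rcases (hX _ hd₁ _ d.adj).resolve_left hd₂ with h | h
    exacts [.inl (h ▸ this), .inr (h ▸ this)]
  have chord : x ∈ c.support → y ∈ c.support → s(x, y) ∈ p.edges ∨ s(x, y) ∈ q.edges := by
    intro hxc hyc
    rw [← List.mem_append, ← Walk.edges_append, Walk.take_spec, (c.rotate_edges b hb).mem_iff]
    exact cc.mem_edges hxc hyc hxy
  have mem_c : ∀ z, z ∈ p.support ∨ z ∈ q.support → z ∈ c.support := by
    intro z hz
    rwa [← c.mem_support_rotate_iff b hb, ← Walk.take_spec _ hsd, Walk.mem_support_append_iff]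
  have meets_q : x ∈ q.support ∨ y ∈ q.support := by simpa using meets q.reverse
  grind [Walk.fst_mem_support_of_mem_edges, Walk.snd_mem_support_of_mem_edges]

end Cycles

section Directed

/-- All darts of the walk `p` are arcs, or the reversals of all of them are: the walk is directed
with respect to the relation `arc`, in one of its two directions. -/
def IsDirected (arc : V → V → Prop) {u v : V} (p : G.Walk u v) : Prop :=
  (∀ d ∈ p.darts, arc d.fst d.snd) ∨ (∀ d ∈ p.darts, arc d.snd d.fst)

variable {r r' : V → V → Prop} {u v : V}

theorem IsDirected.mono {p : G.Walk u v} (h : IsDirected r p)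
    (hr : ∀ a ∈ p.support, ∀ b ∈ p.support, r a b → r' a b) : IsDirected r' p :=
  have fst d hd := p.dart_fst_mem_support_of_mem_darts (d := d) hd
  have snd d hd := p.dart_snd_mem_support_of_mem_darts (d := d) hd
  h.imp (fun h d hd => hr _ (fst d hd) _ (snd d hd) (h d hd))
    fun h d hd => hr _ (snd d hd) _ (fst d hd) (h d hd)

theorem isDirected_map {W : Type*} {H : SimpleGraph W} (f : H →g G) {a b : W} {p : H.Walk a b} :
    IsDirected r (p.map f) ↔ IsDirected (fun x y => r (f x) (f y)) p := by
  simp only [IsDirected, Walk.darts_map, List.forall_mem_map]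
  rfl

theorem isDirected_of_biUnique (hr : Relator.BiUnique r) {p : G.Walk u v} (hp : p.IsTrail)
    (h : ∀ d ∈ p.darts, r d.fst d.snd ∨ r d.snd d.fst) : IsDirected r p := by
  induction p with
  | nil => exact .inl (by simp)
  | @cons a b _ hab p ih =>
    rw [Walk.isTrail_cons] at hp
    simp only [Walk.darts_cons, List.forall_mem_cons] at h
    cases p with
    | nil => exact h.1.imp (fun h => by simpa using h) fun h => by simpa using h
    | @cons _ c _ hbc p =>
      have hac : a ≠ c := by
        rintro rfl
        exact hp.2 (by simp [Sym2.eq_swap])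
      rcases ih hp.1 h.2 with hdir | hdir
      · refine .inl (List.forall_mem_cons.2 ⟨h.1.resolve_right fun hba => hac ?_, hdir⟩)
        exact hr.2 hba (hdir ⟨(b, c), hbc⟩ (by simp))
      · refine .inr (List.forall_mem_cons.2 ⟨h.1.resolve_left fun hba => hac ?_, hdir⟩)
        exact hr.1 hba (hdir ⟨(b, c), hbc⟩ (by simp))

/-- The walk `p` traverses an edge in the direction from `a` to `b`. For a cycle `p` this is the
cyclic orientation of its edges. -/
def dartRel {u v : V} (p : G.Walk u v) (a b : V) : Prop :=
  ∃ d ∈ p.darts, d.fst = a ∧ d.snd = b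

theorem dartRel_or_dartRel {p : G.Walk u v} {a b : V} (h : s(a, b) ∈ p.edges) :
    dartRel p a b ∨ dartRel p b a := by
  obtain ⟨d, hd, hde⟩ := List.mem_map.1 h
  rcases Sym2.eq_iff.1 hde with h | h
  exacts [.inl ⟨d, hd, h⟩, .inr ⟨d, hd, h⟩]

theorem not_dartRel_of_dartRel {p : G.Walk u v} (hp : p.IsTrail) {a b : V} (h : dartRel p a b) :
    ¬ dartRel p b a := by
  rintro ⟨d', hd', rfl, rfl⟩
  obtain ⟨d, hd, h₁, h₂⟩ := h
  obtain rfl : d = d' := List.inj_on_of_nodup_map hp.edges_nodup hd hd'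
    (Sym2.eq_iff.2 (.inr ⟨h₁, h₂⟩))
  exact d.fst_ne_snd h₁

theorem biUnique_dartRel {c : G.Walk u u} (hc : c.IsCycle) : Relator.BiUnique (dartRel c) := by
  constructor
  · rintro _ _ _ ⟨d, hd, rfl, rfl⟩ ⟨d', hd', rfl, h⟩
    have hnd : (c.darts.map (·.snd)).Nodup := by
      rw [Walk.map_snd_darts]
      exact hc.support_nodup
    rw [List.inj_on_of_nodup_map hnd hd hd' h.symm]
  · rintro _ _ _ ⟨d, hd, rfl, rfl⟩ ⟨d', hd', h, rfl⟩
    have hnd : (c.darts.map (·.fst)).Nodup := by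
      rw [Walk.map_fst_darts]
      exact hc.nodup_dropLast_support
    rw [List.inj_on_of_nodup_map hnd hd hd' h.symm]

end Directed

section Orientations

theorem exists_orientation_of_asymm {r : V → V → Prop} (hr : ∀ a b, r a b → G.Adj a b)
    (hasymm : ∀ a b, r a b → ¬ r b a) :
    ∃ o : GraphOrientation G, ∀ a b, r a b → o.arc a b := by
  have hlt : ∀ a b : V, WellOrderingRel a b → ¬ WellOrderingRel b a := fun _ _ => asymm
  refine ⟨⟨fun a b => r a b ∨ (G.Adj a b ∧ ¬ r b a ∧ WellOrderingRel a b), ?_, ?_, ?_⟩,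
    fun a b => .inl⟩
  · rintro a b (h | h)
    exacts [hr a b h, h.1]
  · intro a b hab
    rcases trichotomous_of WellOrderingRel a b with h | rfl | h
    · by_cases hba : r b a
      exacts [.inr (.inl hba), .inl (.inr ⟨hab, hba, h⟩)]
    · exact (hab.ne rfl).elim
    · by_cases hba : r a b
      exacts [.inl (.inl hba), .inr (.inr ⟨hab.symm, hba, h⟩)]
  · rintro a b (h | ⟨-, h, h'⟩) (g | ⟨-, g, g'⟩)
    exacts [hasymm a b h g, g h, h g, hlt a b h' g']

instance : Nonempty (GraphOrientation G) :=
  let ⟨o, _⟩ := exists_orientation_of_asymm (G := G) (r := fun _ _ => False)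
    (fun _ _ => False.elim) fun _ _ => False.elim
  ⟨o⟩

/-- The orientation `o` of `G` directs every chordless cycle inside the vertex set `S`, i.e. it
restricts to a cyclic orientation of the subgraph induced by `S`. -/
def GraphOrientation.IsCyclicOn (o : GraphOrientation G) (S : Set V) : Prop :=
  ∀ (u : V) (c : G.Walk u u), c.IsCycle → c.IsChordless → (∀ z ∈ c.support, z ∈ S) →
    IsDirected o.arc c

theorem GraphOrientation.IsCyclic.isCyclicOn {o : GraphOrientation G} (ho : o.IsCyclic)
    (S : Set V) : o.IsCyclicOn S :=
  fun u c hc cc _ => ho u c hc cc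

theorem cyclicallyOrientable_induce_iff {S : Set V} :
    CyclicallyOrientable (G.induce S) ↔ ∃ o : GraphOrientation G, o.IsCyclicOn S := by
  have hinj : Function.Injective (Embedding.induce (G := G) S).toHom := Subtype.val_injective
  constructor
  · rintro ⟨o', ho'⟩
    obtain ⟨o, ho⟩ := exists_orientation_of_asymm (G := G)
      (r := fun a b => ∃ (ha : a ∈ S) (hb : b ∈ S), o'.arc ⟨a, ha⟩ ⟨b, hb⟩)
      (fun a b ⟨_, _, h⟩ => o'.adj_of_arc h) (fun a b ⟨_, _, h⟩ ⟨_, _, h'⟩ => o'.asymm h h')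
    refine ⟨o, fun u c hc cc hcS => ?_⟩
    rw [← c.map_induce hcS] at hc cc ⊢
    refine (isDirected_map (Embedding.induce S).toHom).2 (IsDirected.mono (r := o'.arc) ?_ ?_)
    · exact ho' _ _ ((Walk.isCycle_map_iff_of_injective hinj).1 hc) ((isChordless_map_iff _).1 cc)
    · exact fun a _ b _ h => ho a b ⟨a.2, b.2, h⟩
  · rintro ⟨o, ho⟩
    refine ⟨⟨fun a b => o.arc a b, o.adj_of_arc, o.arc_or_arc, o.asymm⟩, fun u c hc cc => ?_⟩
    refine (isDirected_map (Embedding.induce S).toHom).1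
      (ho _ _ ((Walk.isCycle_map_iff_of_injective hinj).2 hc) ((isChordless_map_iff _).2 cc) ?_)
    simp only [Walk.support_map, List.forall_mem_map]
    exact fun z _ => z.2

theorem coe_eq_induce_of_isInduced {B : G.Subgraph} (hB : B.IsInduced) :
    B.coe = G.induce B.verts := by
  ext a b
  exact ⟨fun h => B.adj_sub h, fun h => hB a.2 b.2 h⟩

theorem cyclicallyOrientable_coe_iff {B : G.Subgraph} (hB : B.IsInduced) :
    CyclicallyOrientable B.coe ↔ ∃ o : GraphOrientation G, o.IsCyclicOn B.verts := by
  rw [coe_eq_induce_of_isInduced hB, cyclicallyOrientable_induce_iff]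

theorem CyclicallyOrientable.coe (hG : CyclicallyOrientable G) {B : G.Subgraph}
    (hB : B.IsInduced) : CyclicallyOrientable B.coe := by
  obtain ⟨o, ho⟩ := hG
  exact (cyclicallyOrientable_coe_iff hB).2 ⟨o, ho.isCyclicOn _⟩

theorem cyclicallyOrientable_of_forall_eq_or_eq {v w : V} (h : ∀ z : V, z = v ∨ z = w) :
    CyclicallyOrientable G := by
  refine ⟨Classical.arbitrary _, fun u c hc _ => ?_⟩
  obtain ⟨z, -, hzv, hzw⟩ := exists_mem_support_ne_ne hc v w
  exact ((h z).elim hzv hzw).elim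

end Orientations

section Gluing

variable {H K : G.Subgraph} {v w : V} {hvw : G.Adj v w}

theorem adj_or_adj_of_sup_eq_top (hsup : H ⊔ K = ⊤) {a b : V} (hab : G.Adj a b) :
    H.Adj a b ∨ K.Adj a b := by
  rw [← Subgraph.sup_adj, hsup]
  exact hab

theorem eq_or_eq_of_inf_eq_subgraphOfAdj (hinf : H ⊓ K = G.subgraphOfAdj hvw) {a : V}
    (ha : a ∈ H.verts) (ha' : a ∈ K.verts) : a = v ∨ a = w := by
  have : a ∈ (H ⊓ K).verts := ⟨ha, ha'⟩
  rw [hinf] at this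
  simpa using this

theorem adj_and_adj_of_inf_eq_subgraphOfAdj (hinf : H ⊓ K = G.subgraphOfAdj hvw) :
    H.Adj v w ∧ K.Adj v w := by
  rw [← Subgraph.inf_adj, hinf, subgraphOfAdj_adj]

theorem isInduced_of_inf_eq_subgraphOfAdj (hsup : H ⊔ K = ⊤)
    (hinf : H ⊓ K = G.subgraphOfAdj hvw) : H.IsInduced := by
  intro a ha b hb hab
  rcases adj_or_adj_of_sup_eq_top hsup hab with h | h
  · exact h
  · have hH := (adj_and_adj_of_inf_eq_subgraphOfAdj hinf).1
    rcases eq_or_eq_of_inf_eq_subgraphOfAdj hinf ha (K.edge_vert h) with rfl | rfl <;>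
      rcases eq_or_eq_of_inf_eq_subgraphOfAdj hinf hb (K.edge_vert h.symm) with rfl | rfl
    exacts [(hab.ne rfl).elim, hH, hH.symm, (hab.ne rfl).elim]

theorem support_subset_of_inf_eq_subgraphOfAdj (hsup : H ⊔ K = ⊤)
    (hinf : H ⊓ K = G.subgraphOfAdj hvw) {u : V} {c : G.Walk u u} (hc : c.IsCycle)
    (cc : c.IsChordless) : (∀ z ∈ c.support, z ∈ H.verts) ∨ ∀ z ∈ c.support, z ∈ K.verts := by
  have hHK := adj_and_adj_of_inf_eq_subgraphOfAdj hinf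
  refine or_iff_not_imp_left.2 fun hcH => ?_
  push Not at hcH
  have hK : ∀ a ∉ H.verts, ∀ b, G.Adj a b → K.Adj a b := fun a ha b hab =>
    (adj_or_adj_of_sup_eq_top hsup hab).resolve_left fun h => ha (H.edge_vert h)
  have hv : v ∉ H.vertsᶜ := not_not.2 (H.edge_vert hHK.1)
  have hw : w ∉ H.vertsᶜ := not_not.2 (H.edge_vert hHK.1.symm)
  have hX : ∀ a ∈ H.vertsᶜ, ∀ b, G.Adj a b → b ∈ H.vertsᶜ ∨ b = v ∨ b = w := fun a ha b hab =>
    or_iff_not_imp_left.2 fun hb =>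
      eq_or_eq_of_inf_eq_subgraphOfAdj hinf (not_not.1 hb) (K.edge_vert (hK a ha b hab).symm)
  intro z hz
  rcases support_subset_of_isChordless hvw hv hw hX hc cc hcH z hz with h | rfl | rfl
  · have hzt : z ∈ (H ⊔ K).verts := by rw [hsup]; trivial
    exact hzt.resolve_left h
  · exact K.edge_vert hHK.2
  · exact K.edge_vert hHK.2.symm

theorem GraphOrientation.IsCyclicOn.cyclicallyOrientable_of_gluing {o : GraphOrientation G}
    (ho : o.IsCyclicOn H.verts) (harc : o.arc v w) {p : G.Walk w v}
    (hp : (Walk.cons hvw p).IsCycle) (hsup : H ⊔ (Walk.cons hvw p).toSubgraph = ⊤)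
    (hinf : H ⊓ (Walk.cons hvw p).toSubgraph = G.subgraphOfAdj hvw) : CyclicallyOrientable G := by
  set c := Walk.cons hvw p with hcdef
  have hvwc : dartRel c v w := ⟨⟨(v, w), hvw⟩, by simp [hcdef], rfl, rfl⟩
  have mem_c : ∀ {a b}, dartRel c a b → a ∈ c.toSubgraph.verts ∧ b ∈ c.toSubgraph.verts := by
    rintro _ _ ⟨d, hd, rfl, rfl⟩
    exact ⟨c.mem_verts_toSubgraph.2 (c.dart_fst_mem_support_of_mem_darts hd),
      c.mem_verts_toSubgraph.2 (c.dart_snd_mem_support_of_mem_darts hd)⟩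
  have not_both : ∀ {a b}, a ∈ H.verts → b ∈ H.verts → o.arc a b → ¬ dartRel c b a := by
    intro a b ha hb hab hba
    rcases eq_or_eq_of_inf_eq_subgraphOfAdj hinf ha (mem_c hba).2 with rfl | rfl <;>
      rcases eq_or_eq_of_inf_eq_subgraphOfAdj hinf hb (mem_c hba).1 with rfl | rfl
    exacts [o.asymm hab hab, not_dartRel_of_dartRel hp.isTrail hvwc hba, o.asymm harc hab,
      o.asymm hab hab]
  obtain ⟨o', ho'⟩ := exists_orientation_of_asymm (G := G)
    (r := fun a b => (a ∈ H.verts ∧ b ∈ H.verts ∧ o.arc a b) ∨ dartRel c a b)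
    (by
      rintro a b (⟨-, -, h⟩ | ⟨d, -, rfl, rfl⟩)
      exacts [o.adj_of_arc h, d.adj])
    (by
      rintro a b (⟨ha, hb, h⟩ | h) (⟨hb', ha', h'⟩ | h')
      exacts [o.asymm h h', not_both ha hb h h', not_both hb' ha' h' h,
        not_dartRel_of_dartRel hp.isTrail h h'])
  refine ⟨o', fun u d hd cd => ?_⟩
  rcases support_subset_of_inf_eq_subgraphOfAdj hsup hinf hd cd with hdH | hdc
  · exact (ho u d hd cd hdH).mono fun a ha b hb h => ho' a b (.inl ⟨hdH a ha, hdH b hb, h⟩)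
  · have hind : c.toSubgraph.IsInduced :=
      isInduced_of_inf_eq_subgraphOfAdj (sup_comm H _ ▸ hsup) (inf_comm H _ ▸ hinf)
    refine IsDirected.mono (isDirected_of_biUnique (biUnique_dartRel hp) hd.isTrail fun e he => ?_)
      fun a _ b _ h => ho' a b (.inr h)
    exact dartRel_or_dartRel (Walk.adj_toSubgraph_iff_mem_edges.1
      (hind (hdc _ (d.dart_fst_mem_support_of_mem_darts he))
        (hdc _ (d.dart_snd_mem_support_of_mem_darts he)) e.adj))

theorem IsCycleGluing.cyclicallyOrientable_iff (h : IsCycleGluing G H K) :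
    CyclicallyOrientable G ↔ CyclicallyOrientable H.coe := by
  obtain ⟨⟨u, c, hc, rfl⟩, hsup, v, w, hvw, hinf⟩ := h
  have hind := isInduced_of_inf_eq_subgraphOfAdj hsup hinf
  refine ⟨fun hG => hG.coe hind, fun hH => ?_⟩
  obtain ⟨o, ho⟩ := (cyclicallyOrientable_coe_iff hind).1 hH
  wlog harc : o.arc v w generalizing v w
  · exact this w v hvw.symm (hinf.trans (SimpleGraph.subgraphOfAdj_symm hvw).symm)
      ((o.arc_or_arc hvw).resolve_left harc)
  obtain ⟨_, p, hp, hpc⟩ := exists_isCycle_cons hc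
    (Walk.adj_toSubgraph_iff_mem_edges.1 (adj_and_adj_of_inf_eq_subgraphOfAdj hinf).2)
  exact ho.cyclicallyOrientable_of_gluing harc hp (hpc ▸ hsup) (hpc ▸ hinf)

theorem cyclicallyOrientable_coe_subgraphOfAdj (hvw : G.Adj v w) :
    CyclicallyOrientable (G.subgraphOfAdj hvw).coe := by
  refine cyclicallyOrientable_of_forall_eq_or_eq (v := ⟨v, .inl rfl⟩) (w := ⟨w, .inr rfl⟩) ?_
  rintro ⟨z, rfl | rfl⟩
  exacts [.inl rfl, .inr rfl]

theorem IsCycleGraph.cyclicallyOrientable (h : IsCycleGraph G) : CyclicallyOrientable G := by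
  obtain ⟨u, c, hc, -⟩ := id h
  have hadj := c.adj_snd hc.not_nil
  have hglue : IsCycleGluing G (G.subgraphOfAdj hadj) ⊤ :=
    ⟨h, sup_top_eq _, u, c.snd, hadj, inf_top_eq _⟩
  exact hglue.cyclicallyOrientable_iff.2 (cyclicallyOrientable_coe_subgraphOfAdj hadj)

theorem IsSingleEdge.cyclicallyOrientable (h : IsSingleEdge G) : CyclicallyOrientable G := by
  obtain ⟨v, w, hvw, htop⟩ := h
  refine cyclicallyOrientable_of_forall_eq_or_eq (v := v) (w := w) fun z => ?_
  have hz : z ∈ (⊤ : G.Subgraph).verts := trivial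
  rw [htop] at hz
  simpa using hz

end Gluing

section Blocks

theorem edgeRel_of_paths {a b : V} {p : G.Walk a b} {q : G.Walk b a} (hp : p.IsPath)
    (hq : q.IsPath) (hpq : ∀ z ∈ p.support, z ∈ q.support → z = a ∨ z = b) {e g : Sym2 V}
    (he : e ∈ p.edges) (hg : g ∈ q.edges) : EdgeRel G e g := by
  by_cases hlen : 1 < p.length ∨ 1 < q.length
  · refine .inr ⟨a, p.append q, hp.isCycle_append hq ?_ hlen, by simp [he], by simp [hg]⟩
    intro z hzp hzq
    have hp' := hp.support_nodup
    have hq' := hq.support_nodup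
    rw [← Walk.cons_tail_support, List.nodup_cons] at hp' hq'
    rcases hpq z (List.mem_of_mem_tail hzp) (List.mem_of_mem_tail hzq) with rfl | rfl
    exacts [hp'.1 hzp, hq'.1 hzq]
  · push Not at hlen
    have eq_of_length_le_one : ∀ {x y : V} (r : G.Walk x y) {f : Sym2 V}, r.length ≤ 1 →
        f ∈ r.edges → f = s(x, y)
      | _, _, .cons _ .nil, _, _, hf => by simpa using hf
      | _, _, .cons _ (.cons _ _), _, hr, _ => by simp at hr
    rw [eq_of_length_le_one p hlen.1 he, eq_of_length_le_one q hlen.2 hg, Sym2.eq_swap]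
    exact .inl rfl

theorem edgeRel_of_ear {u x y : V} {c : G.Walk u u} (hc : c.IsCycle) (hx : x ∈ c.support)
    (hy : y ∈ c.support) {p : G.Walk x y} (hp : p.IsPath)
    (hpc : ∀ z ∈ p.support, z ∈ c.support → z = x ∨ z = y) {e g : Sym2 V} (he : e ∈ c.edges)
    (hg : g ∈ p.edges) : EdgeRel G e g := by
  classical
  have hxy : x ≠ y := by
    rintro rfl
    rw [(Walk.isPath_iff_nil.1 hp).eq_nil] at hg
    simp at hg
  have hd : (c.rotate x hx).IsCycle := hc.rotate hx
  have hyd : y ∈ (c.rotate x hx).support := (c.mem_support_rotate_iff x hx).2 hy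
  have hsub : ∀ z ∈ (c.rotate x hx).support, z ∈ c.support := fun z hz =>
    (c.mem_support_rotate_iff x hx).1 hz
  rw [← (c.rotate_edges x hx).mem_iff, ← Walk.take_spec _ hyd, Walk.edges_append,
    List.mem_append] at he
  rcases he with he | he
  · refine edgeRel_of_paths (hd.isPath_takeUntil hyd) hp.reverse (fun z hz hzp => ?_) he
      (by simpa using hg)
    exact hpc z (by simpa using hzp) (hsub z (Walk.support_takeUntil_subset_support _ hyd hz))
  · have hdrop : ((c.rotate x hx).dropUntil y hyd).IsPath :=
      Walk.IsCycle.isPath_of_append_right (by rwa [Walk.nil_takeUntil])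
        ((Walk.take_spec _ hyd).symm ▸ hd)
    refine edgeRel_of_paths hdrop hp (fun z hz hzp => ?_) he hg
    exact (hpc z hzp (hsub z (Walk.support_dropUntil_subset_support _ hyd hz))).symm

theorem exists_path_through_edge {S : Set V} {g : Sym2 V} {a b : V} {p : G.Walk a b}
    (hp : p.IsPath) (ha : a ∈ S) (hb : b ∈ S) (hg : g ∈ p.edges) :
    ∃ x ∈ S, ∃ y ∈ S, ∃ q : G.Walk x y, q.IsPath ∧ g ∈ q.edges ∧
      ∀ z ∈ q.support, z ∈ S → z = x ∨ z = y := by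
  classical
  induction hn : p.length using Nat.strong_induction_on generalizing a b with
  | _ n ih =>
    subst hn
    by_cases hS : ∀ z ∈ p.support, z ∈ S → z = a ∨ z = b
    · exact ⟨a, ha, b, hb, p, hp, hg, hS⟩
    · push Not at hS
      obtain ⟨z, hz, hzS, hza, hzb⟩ := hS
      rw [← p.take_spec hz, Walk.edges_append, List.mem_append] at hg
      rcases hg with hg | hg
      · exact ih _ (Walk.length_takeUntil_lt_length hz hzb) (hp.takeUntil hz) ha hzS hg rfl
      · exact ih _ (Walk.length_dropUntil_lt_length hz hza) (hp.dropUntil hz) hzS hb hg rfl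

theorem EdgeRel.symm {e f : Sym2 V} (h : EdgeRel G e f) : EdgeRel G f e := by
  rcases h with rfl | ⟨u, c, hc, he, hf⟩
  exacts [.inl rfl, .inr ⟨u, c, hc, hf, he⟩]

theorem EdgeRel.trans {e f g : Sym2 V} (h : EdgeRel G e f) (h' : EdgeRel G f g) :
    EdgeRel G e g := by
  rcases h with rfl | ⟨u, c, hc, he, hf⟩
  · exact h'
  rcases h' with rfl | ⟨v, d, hd, hfd, hg⟩
  · exact .inr ⟨u, c, hc, he, hf⟩
  induction f using Sym2.ind with | h a b => ?_
  obtain ⟨hab, p, hp, hpd⟩ := exists_isCycle_cons hd hfd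
  rw [← Walk.mem_edges_toSubgraph, ← hpd, Walk.mem_edges_toSubgraph, Walk.edges_cons,
    List.mem_cons] at hg
  rcases hg with rfl | hg
  · exact .inr ⟨u, c, hc, he, hf⟩
  obtain ⟨x, hx, y, hy, q, hq, hgq, hqc⟩ := exists_path_through_edge (S := {z | z ∈ c.support})
    ((Walk.cons_isCycle_iff p hab).1 hp).1 (c.snd_mem_support_of_mem_edges hf)
    (c.fst_mem_support_of_mem_edges hf) hg
  exact edgeRel_of_ear hc hx hy hq hqc he hgq

theorem EdgeRel.of_adj {f g : Sym2 V} {a b : V} (h : EdgeRel G f g) (ha : a ∈ f) (hb : b ∈ g)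
    (hab : G.Adj a b) : EdgeRel G f s(a, b) := by
  rcases h with rfl | ⟨u, c, hc, hf, hg⟩
  · exact .inl ((Sym2.mem_and_mem_iff hab.ne).1 ⟨ha, hb⟩)
  · refine edgeRel_of_ear hc (c.mem_support_of_mem_edges hf ha)
      (c.mem_support_of_mem_edges hg hb) hab.isPath_toWalk (fun z hz _ => ?_) hf
      (by simp [SimpleGraph.Adj.toWalk])
    simpa [hab.support_toWalk] using hz

/-- The subgraph formed by the edges in the class of `e` and their endpoints: the two-connected
component of `G` that contains the edge `e`. -/
def edgeClassSubgraph (G : SimpleGraph V) (e : Sym2 V) : G.Subgraph where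
  verts := {x | ∃ f ∈ G.edgeSet, EdgeRel G e f ∧ x ∈ f}
  Adj a b := G.Adj a b ∧ EdgeRel G e s(a, b)
  adj_sub h := h.1
  edge_vert {a b} h := ⟨s(a, b), h.1, h.2, Sym2.mem_mk_left a b⟩
  symm := ⟨fun _ _ h => ⟨h.1.symm, by rw [Sym2.eq_swap]; exact h.2⟩⟩

theorem edgeSet_edgeClassSubgraph (e : Sym2 V) :
    (edgeClassSubgraph G e).edgeSet = {f | f ∈ G.edgeSet ∧ EdgeRel G e f} := by
  ext ⟨a, b⟩
  rfl

theorem edgeClassSubgraph_eq {e f : Sym2 V} (h : EdgeRel G e f) :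
    edgeClassSubgraph G e = edgeClassSubgraph G f := by
  have hiff : ∀ g, EdgeRel G e g ↔ EdgeRel G f g := fun g => ⟨h.symm.trans, h.trans⟩
  ext a b <;> simp only [edgeClassSubgraph, hiff]

theorem toSubgraph_le_edgeClassSubgraph {u : V} {c : G.Walk u u} (hc : c.IsCycle) {e : Sym2 V}
    (he : e ∈ c.edges) : c.toSubgraph ≤ edgeClassSubgraph G e := by
  rw [Walk.toSubgraph_le_iff hc.not_nil, edgeSet_edgeClassSubgraph]
  exact fun f hf => ⟨c.edges_subset_edgeSet hf, .inr ⟨u, c, hc, he, hf⟩⟩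

theorem EdgeRel.exists_connected_le_edgeClassSubgraph {e f : Sym2 V} (h : EdgeRel G e f)
    (he : e ∈ G.edgeSet) :
    ∃ H ≤ edgeClassSubgraph G e, H.Connected ∧ e ∈ H.edgeSet ∧ f ∈ H.edgeSet := by
  rcases h with rfl | ⟨u, c, hc, hec, hfc⟩
  · induction e using Sym2.ind with | h a b => ?_
    have hab : G.Adj a b := he
    exact ⟨G.subgraphOfAdj hab,
      subgraphOfAdj_le_of_adj (edgeClassSubgraph G s(a, b)) ⟨hab, .inl rfl⟩,
      Subgraph.subgraphOfAdj_connected hab, by simp, by simp⟩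
  · exact ⟨c.toSubgraph, toSubgraph_le_edgeClassSubgraph hc hec, c.toSubgraph_connected,
      c.mem_edges_toSubgraph.2 hec, c.mem_edges_toSubgraph.2 hfc⟩

theorem connected_edgeClassSubgraph {e : Sym2 V} (he : e ∈ G.edgeSet) :
    (edgeClassSubgraph G e).Connected := by
  induction e using Sym2.ind with | h a b => ?_
  have walk_to : ∀ x ∈ (edgeClassSubgraph G s(a, b)).verts, ∃ p : G.Walk a x,
      p.toSubgraph ≤ edgeClassSubgraph G s(a, b) := by
    rintro x ⟨f, -, hef, hxf⟩
    obtain ⟨H, hle, hH, heH, hfH⟩ := hef.exists_connected_le_edgeClassSubgraph he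
    obtain ⟨p, hp⟩ := (H.connected_iff_forall_exists_walk_subgraph.1 hH).2
      (H.mem_verts_of_mem_edge heH (Sym2.mem_mk_left a b)) (H.mem_verts_of_mem_edge hfH hxf)
    exact ⟨p, hp.trans hle⟩
  rw [Subgraph.connected_iff_forall_exists_walk_subgraph]
  refine ⟨⟨a, _, he, .inl rfl, Sym2.mem_mk_left a b⟩, fun {x y} hx hy => ?_⟩
  obtain ⟨p, hp⟩ := walk_to x hx
  obtain ⟨q, hq⟩ := walk_to y hy
  refine ⟨p.reverse.append q, ?_⟩
  rw [Walk.toSubgraph_append, Walk.toSubgraph_reverse]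
  exact sup_le hp hq

theorem isInduced_edgeClassSubgraph (e : Sym2 V) : (edgeClassSubgraph G e).IsInduced := by
  rintro a ⟨f, -, hef, haf⟩ b ⟨g, -, heg, hbg⟩ hab
  exact ⟨hab, hef.trans ((hef.symm.trans heg).of_adj haf hbg hab)⟩

theorem isTwoConnectedComponent_edgeClassSubgraph {e : Sym2 V} (he : e ∈ G.edgeSet) :
    IsTwoConnectedComponent G (edgeClassSubgraph G e) :=
  ⟨connected_edgeClassSubgraph he, isInduced_edgeClassSubgraph e, e, he,
    edgeSet_edgeClassSubgraph e⟩

theorem cyclicallyOrientable_of_forall_isTwoConnectedComponent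
    (h : ∀ B : G.Subgraph, IsTwoConnectedComponent G B → CyclicallyOrientable B.coe) :
    CyclicallyOrientable G := by
  have hB : ∀ B : G.Subgraph, IsTwoConnectedComponent G B →
      ∃ o : GraphOrientation G, o.IsCyclicOn B.verts :=
    fun B hB => (cyclicallyOrientable_coe_iff hB.2.1).1 (h B hB)
  choose! o ho using hB
  let O : GraphOrientation G :=
    { arc a b := (o (edgeClassSubgraph G s(a, b))).arc a b
      adj_of_arc h := GraphOrientation.adj_of_arc _ h
      arc_or_arc {a b} hab := by
        rw [Sym2.eq_swap (a := b)]
        exact GraphOrientation.arc_or_arc _ hab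
      asymm {a b} h := by
        rw [Sym2.eq_swap]
        exact GraphOrientation.asymm _ h }
  refine ⟨O, fun u c hc cc => ?_⟩
  have he : s(u, c.snd) ∈ c.edges := c.mk_start_snd_mem_edges hc.not_nil
  have hle := toSubgraph_le_edgeClassSubgraph hc he
  have hO : ∀ a b, s(a, b) ∈ c.edges →
      edgeClassSubgraph G s(u, c.snd) = edgeClassSubgraph G s(a, b) :=
    fun a b hab => edgeClassSubgraph_eq (.inr ⟨u, c, hc, he, hab⟩)
  refine (ho _ (isTwoConnectedComponent_edgeClassSubgraph (c.edges_subset_edgeSet he)) u c hc cc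
    fun z hz => hle.1 (c.mem_verts_toSubgraph.2 hz)).imp (fun h d hd => ?_) fun h d hd => ?_
  · change (o (edgeClassSubgraph G s(d.fst, d.snd))).arc _ _
    rw [← hO _ _ (List.mem_map_of_mem hd)]
    exact h d hd
  · change (o (edgeClassSubgraph G s(d.snd, d.fst))).arc _ _
    rw [Sym2.eq_swap, ← hO _ _ (List.mem_map_of_mem hd)]
    exact h d hd

end Blocks

section TwoLinked

theorem preconnected_induce_iff_forall_exists_walk {A : Set V} :
    (G.induce A).Preconnected ↔
      ∀ x ∈ A, ∀ y ∈ A, ∃ w : G.Walk x y, ∀ z ∈ w.support, z ∈ A := by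
  constructor
  · intro h x hx y hy
    obtain ⟨w⟩ := h ⟨x, hx⟩ ⟨y, hy⟩
    have hw : ∀ z ∈ (w.map (Embedding.induce A).toHom).support, z ∈ A := by
      simp only [Walk.support_map, List.forall_mem_map]
      exact fun z _ => z.2
    exact ⟨_, hw⟩
  · rintro h ⟨x, hx⟩ ⟨y, hy⟩
    obtain ⟨w, hw⟩ := h x hx y hy
    exact ⟨w.induce A hw⟩

/-- The vertex set `S` stays connected after the removal of any vertex `a` of the graph, inside or
outside `S`: the vertex version of two-connectedness, used to grow subgraphs by adding ears. -/
def TwoLinked (G : SimpleGraph V) (S : Set V) : Prop :=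
  ∀ a, (G.induce (S \ {a})).Preconnected

theorem IsTwoConnected.twoLinked (h : IsTwoConnected G) : TwoLinked G Set.univ := by
  classical
  refine fun a => preconnected_induce_iff_forall_exists_walk.2 fun x hx y hy => ?_
  have hxa : a ≠ x := fun h => hx.2 h.symm
  have hya : a ≠ y := fun h => hy.2 h.symm
  suffices ∃ w : G.Walk x y, a ∉ w.support by
    obtain ⟨w, hw⟩ := this
    exact ⟨w, fun z hz => ⟨trivial, fun hza => hw (hza ▸ hz)⟩⟩
  by_cases hxy : x = y
  · subst hxy
    exact ⟨.nil, by simpa using hxa⟩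
  obtain ⟨w⟩ := h.1.preconnected x y
  have hw : ¬ w.Nil := Walk.not_nil_of_ne hxy
  rcases h.2.2 s(x, w.snd) (w.adj_snd hw) s(w.penultimate, y) (w.adj_penultimate hw)
    with heq | ⟨u, c, hc, hcx, hcy⟩
  · rcases Sym2.eq_iff.1 heq with ⟨-, hsnd⟩ | ⟨h, -⟩
    · have hadj : G.Adj x y := hsnd ▸ w.adj_snd hw
      exact ⟨hadj.toWalk, by simp [hadj.support_toWalk, hxa, hya]⟩
    · exact (hxy h).elim
  · have hx' : x ∈ c.support := c.fst_mem_support_of_mem_edges hcx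
    have hy' : y ∈ (c.rotate x hx').support :=
      (c.mem_support_rotate_iff x hx').2 (c.snd_mem_support_of_mem_edges hcy)
    by_cases ha : a ∈ ((c.rotate x hx').takeUntil y hy').support
    · refine ⟨((c.rotate x hx').dropUntil y hy').reverse, fun ha' => ?_⟩
      rw [Walk.support_reverse, List.mem_reverse] at ha'
      exact (eq_or_eq_of_mem_takeUntil_of_mem_dropUntil (hc.rotate hx') hy' ha ha').elim hxa hya
    · exact ⟨_, ha⟩

theorem twoLinked_pair {u v : V} (h : G.Adj u v) : TwoLinked G {u, v} := by
  refine fun a => preconnected_induce_iff_forall_exists_walk.2 fun x hx y hy => ?_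
  by_cases hxy : x = y
  · subst hxy
    exact ⟨.nil, by simpa using hx⟩
  · have hadj : G.Adj x y := by
      rcases hx.1 with rfl | rfl <;> rcases hy.1 with rfl | rfl
      exacts [(hxy rfl).elim, h, h.symm, (hxy rfl).elim]
    refine ⟨hadj.toWalk, ?_⟩
    simpa [hadj.support_toWalk] using And.intro hx hy

/-- Of the two parts into which a vertex divides the path, at most one contains the removed
vertex. -/
theorem TwoLinked.union_support {S : Set V} (hS : TwoLinked G S) {x y : V} (hx : x ∈ S)
    (hy : y ∈ S) {p : G.Walk x y} (hp : p.IsPath) : TwoLinked G (S ∪ {z | z ∈ p.support}) := by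
  classical
  intro a
  have walk_to : ∀ c ∈ (S ∪ {z | z ∈ p.support}) \ {a}, ∃ s ∈ S \ {a}, ∃ q : G.Walk c s,
      ∀ z ∈ q.support, z ∈ (S ∪ {z | z ∈ p.support}) \ {a} := by
    rintro c ⟨hcS | hc, hca⟩
    · exact ⟨c, ⟨hcS, hca⟩, .nil, by simpa using ⟨.inl hcS, hca⟩⟩
    have hc : c ∈ p.support := hc
    by_cases ha : a ∈ (p.takeUntil c hc).support
    · have ha' : ∀ z ∈ (p.dropUntil c hc).support, z ≠ a := by
        rintro z hz rfl
        rw [← p.take_spec hc] at hp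
        exact hp.ne_of_mem_support_of_append (Ne.symm hca) ha hz rfl
      exact ⟨y, ⟨hy, ha' y (Walk.end_mem_support _)⟩, p.dropUntil c hc, fun z hz =>
        ⟨.inr (p.support_dropUntil_subset_support hc hz), ha' z hz⟩⟩
    · refine ⟨x, ⟨hx, fun h => ha (h ▸ Walk.start_mem_support _)⟩, (p.takeUntil c hc).reverse,
        fun z hz => ?_⟩
      rw [Walk.support_reverse, List.mem_reverse] at hz
      exact ⟨.inr (p.support_takeUntil_subset_support hc hz), fun h => ha (h ▸ hz)⟩
  refine preconnected_induce_iff_forall_exists_walk.2 fun c hc d hd => ?_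
  obtain ⟨s, hs, q, hq⟩ := walk_to c hc
  obtain ⟨t, ht, r, hr⟩ := walk_to d hd
  obtain ⟨m, hm⟩ := preconnected_induce_iff_forall_exists_walk.1 (hS a) s hs t ht
  refine ⟨q.append (m.append r.reverse), fun z hz => ?_⟩
  simp only [Walk.mem_support_append_iff, Walk.support_reverse, List.mem_reverse] at hz
  rcases hz with hz | hz | hz
  exacts [hq z hz, ⟨.inl (hm z hz).1, (hm z hz).2⟩, hr z hz]

end TwoLinked

section Attachments

variable {o : GraphOrientation G} {S T : Set V}

theorem GraphOrientation.not_arc_iff (o : GraphOrientation G) {a b : V} (hab : G.Adj a b) :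
    ¬ o.arc a b ↔ o.arc b a :=
  ⟨(o.arc_or_arc hab).resolve_left, fun h => o.asymm h⟩

/-- A shortest walk from `a` to `b` on the vertices of `w` closes up through `x` to a chordless
cycle. -/
theorem GraphOrientation.IsCyclic.arc_iff_not_arc_of_walk (ho : o.IsCyclic) {x a b : V}
    (hxa : G.Adj x a) (hxb : G.Adj x b) (hab : a ≠ b) (w : G.Walk a b) (hx : x ∉ w.support)
    (hw : ∀ z ∈ w.support, G.Adj x z → z = a ∨ z = b) : o.arc x a ↔ ¬ o.arc x b := by
  obtain ⟨q, hq, cq, hqw⟩ := exists_isChordless_path (A := {z | z ∈ w.support}) w fun _ => id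
  have cnil : (Walk.nil : G.Walk x x).IsChordless :=
    isChordless_of_forall_length_le fun _ _ => Nat.zero_le _
  have hdir := ho b _
    (isCycle_cons_append_cons (p := Walk.nil) .nil hq
      (by simpa using fun h => hx (hqw x h)) hxa hxb.symm (.inr hab.symm))
    (isChordless_cons_append_cons cnil cq hxa hxb.symm
      (by simpa using fun z hz hxz => hw z (hqw z hz) hxz))
  rw [o.not_arc_iff hxb]
  rcases hdir with hdir | hdir
  · have hbx : o.arc b x := hdir ⟨(b, x), hxb.symm⟩ (by simp)
    have hxa : o.arc x a := hdir ⟨(x, a), hxa⟩ (by simp)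
    exact iff_of_true hxa hbx
  · have hxb : o.arc x b := hdir ⟨(b, x), hxb.symm⟩ (by simp)
    have hax : o.arc a x := hdir ⟨(x, a), hxa⟩ (by simp)
    exact iff_of_false (o.asymm hax) (o.asymm hxb)

/-- The walk `w` reaches the neighbourhood of `x`, which it avoids, exactly at its end. -/
structure IsApproach (x : V) {y a : V} (w : G.Walk y a) : Prop where
  notMem : x ∉ w.support
  adj : G.Adj x a
  eq_of_adj : ∀ z ∈ w.support, G.Adj x z → z = a

theorem GraphOrientation.IsCyclic.arc_iff_not_arc_of_isApproach (ho : o.IsCyclic) {x y a b : V}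
    {w : G.Walk y a} {w' : G.Walk y b} (hw : IsApproach x w) (hw' : IsApproach x w')
    (hab : a ≠ b) : o.arc x a ↔ ¬ o.arc x b := by
  have mem_or_mem : ∀ z, z ∈ (w.reverse.append w').support ↔ z ∈ w.support ∨ z ∈ w'.support := by
    simp
  refine ho.arc_iff_not_arc_of_walk hw.adj hw'.adj hab (w.reverse.append w') ?_ fun z hz hxz => ?_
  · simpa using ⟨hw.notMem, hw'.notMem⟩
  · exact ((mem_or_mem z).1 hz).imp (hw.eq_of_adj z · hxz) (hw'.eq_of_adj z · hxz)

theorem TwoLinked.exists_isApproach (hS : TwoLinked G S) {x y : V} (hx : x ∈ S) (hy : y ∈ S)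
    (hxy : x ≠ y) {b : V} (hbx : b ≠ x) (hby : b ≠ y) :
    ∃ (a : V) (w : G.Walk y a), IsApproach x w ∧ (∀ z ∈ w.support, z ∈ S) ∧ a ≠ b := by
  classical
  obtain ⟨w, hw⟩ := preconnected_induce_iff_forall_exists_walk.1 (hS b) x ⟨hx, hbx.symm⟩ y
    ⟨hy, hby.symm⟩
  obtain ⟨p, hp, -, hpS⟩ := exists_isChordless_path w hw
  cases p with
  | nil => exact (hxy rfl).elim
  | @cons _ c _ hxc p =>
    rw [Walk.cons_isPath_iff] at hp
    simp only [Walk.support_cons, List.forall_mem_cons] at hpS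
    obtain ⟨a, q, -, -, hqp, hxa, hqa⟩ := exists_isChordless_path_to
      (A := {z | z ∈ p.support}) (R := G.Adj x) p.reverse (by simp) hxc
    exact ⟨a, q, ⟨fun h => hp.2 (hqp x h), hxa, hqa⟩, fun z hz => (hpS.2 z (hqp z hz)).1,
      (hpS.2 a (hqp a q.end_mem_support)).2⟩

/-- The vertex `x` lies outside `T` and its only neighbour in `T` is `t`. -/
structure IsAttachedAt (G : SimpleGraph V) (T : Set V) (x t : V) : Prop where
  notMem : x ∉ T
  mem : t ∈ T
  adj : G.Adj x t
  eq_of_adj : ∀ t' ∈ T, G.Adj x t' → t' = t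

variable {x y z s t r : V}

theorem IsAttachedAt.exists_walk (hT : (G.induce T).Preconnected) (hx : IsAttachedAt G T x s)
    (hy : IsAttachedAt G T y t) : ∃ w : G.Walk y s, ∀ z ∈ w.support, z = y ∨ z ∈ T := by
  obtain ⟨w, hw⟩ := preconnected_induce_iff_forall_exists_walk.1 hT t hy.mem s hx.mem
  refine ⟨.cons hy.adj w, ?_⟩
  simpa using fun z hz => .inr (hw z hz)

/-- The cycle that returns from `y` to `x` through `T` passes through both attaching edges. -/
theorem GraphOrientation.IsCyclic.arc_iff_not_arc_of_isAttachedAt (ho : o.IsCyclic)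
    (hT : (G.induce T).Preconnected) (hx : IsAttachedAt G T x s) (hy : IsAttachedAt G T y t)
    (hxy : G.Adj x y) : o.arc x s ↔ ¬ o.arc y t := by
  have arc_iff : ∀ {x y s t : V}, IsAttachedAt G T x s → IsAttachedAt G T y t → G.Adj x y →
      (o.arc x y ↔ ¬ o.arc x s) := by
    intro x y s t hx hy hxy
    obtain ⟨w, hw⟩ := hx.exists_walk hT hy
    exact ho.arc_iff_not_arc_of_walk hxy hx.adj (ne_of_mem_of_not_mem hx.mem hy.notMem).symm w
      (fun h => (hw x h).elim hxy.ne hx.notMem)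
      fun z hz hxz => (hw z hz).imp_right fun hzT => hx.eq_of_adj z hzT hxz
  have hxs := arc_iff hx hy hxy
  have hyt := arc_iff hy hx hxy.symm
  have hasymm := o.not_arc_iff hxy
  tauto

/-- If `x` and `y` were not adjacent, then from `y` one could approach `x` in three ways, once
through `T` and twice inside `S`. -/
theorem GraphOrientation.IsCyclic.adj_of_isAttachedAt (ho : o.IsCyclic)
    (hT : (G.induce T).Preconnected) (hS : TwoLinked G S) (hST : Disjoint S T) (hx : x ∈ S)
    (hy : y ∈ S) (hxy : x ≠ y) (hxs : IsAttachedAt G T x s) (hyt : IsAttachedAt G T y t) :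
    G.Adj x y := by
  by_contra hnadj
  have hsS : ∀ z ∈ S, s ≠ z := fun z hz h => Set.disjoint_left.1 hST hz (h ▸ hxs.mem)
  obtain ⟨w, hw⟩ := hxs.exists_walk hT hyt
  have hws : IsApproach x w :=
    ⟨fun h => (hw x h).elim hxy hxs.notMem, hxs.adj, fun z hz hxz =>
      hxs.eq_of_adj z ((hw z hz).resolve_left fun h => hnadj (h ▸ hxz)) hxz⟩
  obtain ⟨a, wa, hwa, -, has⟩ := hS.exists_isApproach hx hy hxy (hsS x hx) (hsS y hy)
  obtain ⟨b, wb, hwb, hbS, hba⟩ := hS.exists_isApproach hx hy hxy hwa.adj.ne' fun h =>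
    hnadj (h ▸ hwa.adj)
  have hab := ho.arc_iff_not_arc_of_isApproach hwa hwb hba.symm
  have has := ho.arc_iff_not_arc_of_isApproach hwa hws has
  have hsb := ho.arc_iff_not_arc_of_isApproach hws hwb (hsS b (hbS b wb.end_mem_support))
  tauto

theorem GraphOrientation.IsCyclic.eq_or_eq_of_isAttachedAt (ho : o.IsCyclic)
    (hT : (G.induce T).Preconnected) (hS : TwoLinked G S) (hST : Disjoint S T) (hx : x ∈ S)
    (hy : y ∈ S) (hz : z ∈ S) (hxy : x ≠ y) (hxs : IsAttachedAt G T x s)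
    (hyt : IsAttachedAt G T y t) (hzr : IsAttachedAt G T z r) : z = x ∨ z = y := by
  by_contra! hne
  have hxy_adj := ho.adj_of_isAttachedAt hT hS hST hx hy hxy hxs hyt
  have hxz_adj := ho.adj_of_isAttachedAt hT hS hST hx hz hne.1.symm hxs hzr
  have hyz_adj := ho.adj_of_isAttachedAt hT hS hST hy hz hne.2.symm hyt hzr
  have hxy := ho.arc_iff_not_arc_of_isAttachedAt hT hxs hyt hxy_adj
  have hxz := ho.arc_iff_not_arc_of_isAttachedAt hT hxs hzr hxz_adj
  have hyz := ho.arc_iff_not_arc_of_isAttachedAt hT hyt hzr hyz_adj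
  tauto

end Attachments

section Ears

/-- The walk `q` runs outside `S` and its ends are adjacent to the distinct vertices `x` and `y`
of `S`. The ear in the sense of ear decompositions is `q` extended by these two edges. -/
structure IsEar (S : Set V) (x y : V) {s t : V} (q : G.Walk s t) : Prop where
  left_mem : x ∈ S
  right_mem : y ∈ S
  ne : x ≠ y
  adj_left : G.Adj x s
  adj_right : G.Adj t y
  notMem : ∀ z ∈ q.support, z ∉ S

variable {S : Set V} {x y s t : V} {q : G.Walk s t}

theorem exists_walk_to_boundary {u v : V} (p : G.Walk u v) (hu : u ∉ S) (hv : v ∈ S) :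
    ∃ (t y : V) (q : G.Walk u t), (∀ z ∈ q.support, z ∉ S) ∧ G.Adj t y ∧ y ∈ S ∧
      y ∈ p.support := by
  induction p with
  | nil => exact (hu hv).elim
  | @cons u z v huz p ih =>
    by_cases hz : z ∈ S
    · exact ⟨u, z, .nil, by simpa using hu, huz, hz, by simp⟩
    · obtain ⟨t, y, q, hq, hty, hy, hyp⟩ := ih hz hv
      exact ⟨t, y, .cons huz q, by simpa [hu] using hq, hty, hy, by simp [hyp]⟩

theorem exists_isEar (hG : TwoLinked G Set.univ) (hS : S.Nontrivial) (hne : S ≠ Set.univ) :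
    ∃ (x y s t : V) (q : G.Walk s t), IsEar S x y q := by
  obtain ⟨w, hw⟩ := (Set.ne_univ_iff_exists_notMem S).1 hne
  have exists_walk : ∀ b ∈ S, ∃ (t y : V) (q : G.Walk w t), (∀ z ∈ q.support, z ∉ S) ∧
      G.Adj t y ∧ y ∈ S ∧ y ≠ b := by
    intro b hb
    obtain ⟨v, hv, hvb⟩ := hS.exists_ne b
    obtain ⟨r, hr⟩ := preconnected_induce_iff_forall_exists_walk.1 (hG b) w
      ⟨trivial, fun h => hw (h ▸ hb)⟩ v ⟨trivial, hvb⟩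
    obtain ⟨t, y, q, hq, hty, hy, hyr⟩ := exists_walk_to_boundary r hw hv
    exact ⟨t, y, q, hq, hty, hy, (hr y hyr).2⟩
  obtain ⟨b, hb⟩ := hS.nonempty
  obtain ⟨s, x, q, hq, hsx, hx, -⟩ := exists_walk b hb
  obtain ⟨t, y, q', hq', hty, hy, hyx⟩ := exists_walk x hx
  refine ⟨x, y, s, t, q.reverse.append q', hx, hy, hyx.symm, hsx.symm, hty, fun z hz => ?_⟩
  simp only [Walk.mem_support_append_iff, Walk.support_reverse, List.mem_reverse] at hz
  exact hz.elim (hq z) (hq' z)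

theorem IsEar.isPath_cons_concat (h : IsEar S x y q) (hq : q.IsPath) :
    (Walk.cons h.adj_left (q.concat h.adj_right)).IsPath := by
  refine (hq.concat (fun hy => h.notMem y hy h.right_mem) h.adj_right).cons ?_
  rw [Walk.support_concat]
  simp only [List.mem_append, List.mem_singleton, not_or]
  exact ⟨fun hx => h.notMem x hx h.left_mem, h.ne⟩

/-- An ear of minimal length. -/
structure IsShortestEar (S : Set V) (x y : V) {s t : V} (q : G.Walk s t) : Prop
    extends IsEar S x y q where
  length_le : ∀ {x' y' s' t' : V} {q' : G.Walk s' t'}, IsEar S x' y' q' → q.length ≤ q'.length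

theorem exists_isShortestEar (hG : TwoLinked G Set.univ) (hS : S.Nontrivial)
    (hne : S ≠ Set.univ) : ∃ (x y s t : V) (q : G.Walk s t), IsShortestEar S x y q := by
  obtain ⟨x, y, s, t, q, hq⟩ := exists_isEar hG hS hne
  let L : Set ℕ := {n | ∃ (x y s t : V) (q : G.Walk s t), IsEar S x y q ∧ q.length = n}
  obtain ⟨x, y, s, t, q, hq, hn⟩ := Nat.sInf_mem (s := L) ⟨_, x, y, s, t, q, hq, rfl⟩
  exact ⟨x, y, s, t, q, hq, fun hq' => hn ▸ Nat.sInf_le ⟨_, _, _, _, _, hq', rfl⟩⟩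

theorem IsShortestEar.length_le_of_support_subset (h : IsShortestEar S x y q) (q' : G.Walk s t)
    (hq' : q'.support ⊆ q.support) : q.length ≤ q'.length :=
  h.length_le ⟨h.left_mem, h.right_mem, h.ne, h.adj_left, h.adj_right,
    fun z hz => h.notMem z (hq' hz)⟩

theorem IsShortestEar.isPath (h : IsShortestEar S x y q) : q.IsPath :=
  isPath_of_forall_length_le h.length_le_of_support_subset

theorem IsShortestEar.isChordless (h : IsShortestEar S x y q) : q.IsChordless :=
  isChordless_of_forall_length_le h.length_le_of_support_subset

theorem IsShortestEar.eq_end_of_adj (h : IsShortestEar S x y q) {z r : V} (hz : z ∈ S)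
    (hzx : z ≠ x) (hr : r ∈ q.support) (hzr : G.Adj z r) : r = t := by
  classical
  by_contra hne
  have hle := h.length_le (q' := q.takeUntil r hr) ⟨h.left_mem, hz, hzx.symm, h.adj_left,
    hzr.symm, fun a ha => h.notMem a (q.support_takeUntil_subset_support hr ha)⟩
  exact hle.not_gt (Walk.length_takeUntil_lt_length hr hne)

theorem IsShortestEar.eq_start_of_adj (h : IsShortestEar S x y q) {z r : V} (hz : z ∈ S)
    (hzy : z ≠ y) (hr : r ∈ q.support) (hzr : G.Adj z r) : r = s := by
  classical
  by_contra hne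
  have hle := h.length_le (q' := q.dropUntil r hr) ⟨hz, h.right_mem, hzy, hzr, h.adj_right,
    fun a ha => h.notMem a (q.support_dropUntil_subset_support hr ha)⟩
  exact hle.not_gt (Walk.length_dropUntil_lt_length hr hne)

theorem IsShortestEar.isAttachedAt_left (h : IsShortestEar S x y q) :
    IsAttachedAt G {z | z ∈ q.support} x s :=
  ⟨fun hx => h.notMem x hx h.left_mem, q.start_mem_support, h.adj_left,
    fun _ hr hxr => h.eq_start_of_adj h.left_mem h.ne hr hxr⟩

theorem IsShortestEar.isAttachedAt_right (h : IsShortestEar S x y q) :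
    IsAttachedAt G {z | z ∈ q.support} y t :=
  ⟨fun hy => h.notMem y hy h.right_mem, q.end_mem_support, h.adj_right.symm,
    fun _ hr hyr => h.eq_end_of_adj h.right_mem h.ne.symm hr hyr⟩

theorem IsShortestEar.isAttachedAt (h : IsShortestEar S x y q) {z r : V} (hz : z ∈ S)
    (hzx : z ≠ x) (hr : r ∈ q.support) (hzr : G.Adj z r) :
    IsAttachedAt G {z | z ∈ q.support} z r := by
  refine ⟨fun hzq => h.notMem z hzq hz, hr, hzr, fun r' hr' hzr' => ?_⟩
  rw [h.eq_end_of_adj hz hzx hr' hzr', h.eq_end_of_adj hz hzx hr hzr]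

theorem IsShortestEar.adj_and_eq_or_eq_of_adj (h : IsShortestEar S x y q) (hS : TwoLinked G S)
    {o : GraphOrientation G} (ho : o.IsCyclic) :
    G.Adj x y ∧ ∀ z ∈ S, ∀ r ∈ q.support, G.Adj z r → (z = x ∧ r = s) ∨ (z = y ∧ r = t) := by
  have hT : (G.induce {z | z ∈ q.support}).Preconnected := q.connected_induce_support.preconnected
  have hST : Disjoint S {z | z ∈ q.support} := Set.disjoint_right.2 h.notMem
  refine ⟨ho.adj_of_isAttachedAt hT hS hST h.left_mem h.right_mem h.ne h.isAttachedAt_left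
    h.isAttachedAt_right, fun z hz r hr hzr => ?_⟩
  by_cases hzx : z = x
  · exact .inl ⟨hzx, h.isAttachedAt_left.eq_of_adj r hr (hzx ▸ hzr)⟩
  · refine .inr ⟨?_, h.eq_end_of_adj hz hzx hr hzr⟩
    exact (ho.eq_or_eq_of_isAttachedAt hT hS hST h.left_mem h.right_mem hz h.ne
      h.isAttachedAt_left h.isAttachedAt_right (h.isAttachedAt hz hzx hr hzr)).resolve_left hzx

theorem isCycleGluing_induce {u : V} {c : G.Walk u u} (hc : c.IsCycle) (hx : x ∈ S) (hy : y ∈ S)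
    (hxy : s(x, y) ∈ c.edges) (hcS : ∀ z ∈ c.support, z ∈ S → z = x ∨ z = y)
    (hverts : ∀ z ∉ S, z ∈ c.support) (hedges : ∀ a ∉ S, ∀ b, G.Adj a b → s(a, b) ∈ c.edges) :
    IsCycleGluing G ((⊤ : G.Subgraph).induce S) c.toSubgraph := by
  have hadj : G.Adj x y := c.adj_of_mem_edges hxy
  refine ⟨⟨u, c, hc, rfl⟩, ?_, x, y, hadj, le_antisymm ?_ ?_⟩
  · refine top_le_iff.1 ⟨fun z _ => ?_, fun a b hab => ?_⟩
    · exact or_iff_not_imp_left.2 fun hz => c.mem_verts_toSubgraph.2 (hverts z hz)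
    · rw [Subgraph.sup_adj, Walk.adj_toSubgraph_iff_mem_edges]
      by_cases ha : a ∈ S
      · by_cases hb : b ∈ S
        · exact .inl ⟨ha, hb, hab⟩
        · exact .inr (Sym2.eq_swap ▸ hedges b hb a hab.symm)
      · exact .inr (hedges a ha b hab)
  · have eq_or_eq : ∀ z ∈ S, z ∈ c.toSubgraph.verts → z = x ∨ z = y := fun z hz hzc =>
      hcS z (c.mem_verts_toSubgraph.1 hzc) hz
    refine ⟨fun z hz => eq_or_eq z hz.1 hz.2, fun a b ⟨⟨ha, hb, hab⟩, h⟩ => ?_⟩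
    rcases eq_or_eq a ha (c.toSubgraph.edge_vert h) with rfl | rfl <;>
      rcases eq_or_eq b hb (c.toSubgraph.edge_vert h.symm) with rfl | rfl
    exacts [(hab.ne rfl).elim, rfl, Sym2.eq_swap, (hab.ne rfl).elim]
  · exact subgraphOfAdj_le_of_adj ((⊤ : G.Subgraph).induce S ⊓ c.toSubgraph)
      ⟨⟨hx, hy, hadj⟩, Walk.adj_toSubgraph_iff_mem_edges.2 hxy⟩

theorem IsEar.exists_isCycleGluing (h : IsEar S x y q) (hq : q.IsPath) (cq : q.IsChordless)
    (hxy : G.Adj x y) (huniv : ∀ z ∉ S, z ∈ q.support)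
    (hST : ∀ z ∈ S, ∀ r ∈ q.support, G.Adj z r → (z = x ∧ r = s) ∨ (z = y ∧ r = t)) :
    ∃ C : G.Subgraph, IsCycleGluing G ((⊤ : G.Subgraph).induce S) C := by
  have hxq : x ∉ q.support := fun hx => h.notMem x hx h.left_mem
  have hyq : y ∉ q.support := fun hy => h.notMem y hy h.right_mem
  have hc := isCycle_cons_append_cons hxy.symm.isPath_toWalk hq
    (by simp [hxy.symm.support_toWalk, hxq, hyq]) h.adj_left h.adj_right (.inl h.ne.symm)
  refine ⟨_, isCycleGluing_induce hc h.left_mem h.right_mem ?_ (fun z hz hzS => ?_)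
    (fun z hz => ?_) fun a ha b hab => ?_⟩
  · simp [SimpleGraph.Adj.toWalk, Sym2.eq_swap]
  · have hzq : z ∉ q.support := fun hzq => h.notMem z hzq hzS
    have htq := q.end_mem_support
    simp only [Walk.support_cons, List.mem_cons, Walk.mem_support_append_iff,
      hxy.symm.support_toWalk, List.not_mem_nil, or_false] at hz
    grind
  · simp [huniv z hz]
  · have haq := huniv a ha
    simp only [Walk.edges_cons, List.mem_cons, Walk.edges_append, List.mem_append]
    by_cases hb : b ∈ S
    · rcases hST b hb a haq hab.symm with ⟨rfl, rfl⟩ | ⟨rfl, rfl⟩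
      exacts [.inr (.inr (.inl Sym2.eq_swap)), .inl rfl]
    · exact .inr (.inr (.inr (cq.mem_edges haq (huniv b hb) hab)))

end Ears

section Decomposition

variable {S : Set V}

theorem exists_isCycleGluing_of_maximal (hG : TwoLinked G Set.univ)
    (hS : Maximal (fun S => TwoLinked G S ∧ S.Nontrivial ∧ S ≠ Set.univ) S)
    {o : GraphOrientation G} (ho : o.IsCyclic) :
    ∃ C : G.Subgraph, IsCycleGluing G ((⊤ : G.Subgraph).induce S) C := by
  obtain ⟨hlinked, hnontrivial, hproper⟩ := hS.prop
  obtain ⟨x, y, s, t, q, h⟩ := exists_isShortestEar hG hnontrivial hproper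
  obtain ⟨hxy, hST⟩ := h.adj_and_eq_or_eq_of_adj hlinked ho
  refine h.toIsEar.exists_isCycleGluing h.isPath h.isChordless hxy (fun z hz => ?_) hST
  set S' := S ∪ {z | z ∈ (Walk.cons h.adj_left (q.concat h.adj_right)).support} with hS'
  have hSS' : S ⊆ S' := Set.subset_union_left
  have hs : s ∈ S' := .inr (by simp [Walk.support_concat])
  have hlinked' : TwoLinked G S' :=
    hlinked.union_support h.left_mem h.right_mem (h.isPath_cons_concat h.isPath)
  have hS'univ : S' = Set.univ := by
    by_contra hne
    exact h.notMem s q.start_mem_support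
      (hS.le_of_ge ⟨hlinked', hnontrivial.mono hSS', hne⟩ hSS' hs)
  have hzS' : z ∈ S' := hS'univ ▸ trivial
  have hzx : z ≠ x := fun hzx => hz (hzx ▸ h.left_mem)
  have hzy : z ≠ y := fun hzy => hz (hzy ▸ h.right_mem)
  simpa [hS', Walk.support_concat, hz, hzx, hzy] using hzS'

theorem isSingleEdge_of_forall_eq_or_eq {u v : V} (huv : G.Adj u v)
    (h : ∀ z, z = u ∨ z = v) : IsSingleEdge G := by
  have hle : (⊤ : G.Subgraph) ≤ G.subgraphOfAdj huv := by
    refine ⟨fun z _ => h z, fun a b hab => ?_⟩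
    have hab : G.Adj a b := hab
    rcases h a with rfl | rfl <;> rcases h b with rfl | rfl
    exacts [(hab.ne rfl).elim, rfl, Sym2.eq_swap, (hab.ne rfl).elim]
  exact ⟨u, v, huv, le_antisymm hle le_top⟩

theorem IsTwoConnected.isSingleEdge_or_exists_isCycleGluing [Finite V] (h : IsTwoConnected G)
    (hG : CyclicallyOrientable G) :
    IsSingleEdge G ∨ ∃ G' C : G.Subgraph, IsCycleGluing G G' C := by
  obtain ⟨o, ho⟩ := hG
  obtain ⟨e, he⟩ := h.2.1
  induction e using Sym2.ind with | h u v => ?_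
  have huv : G.Adj u v := he
  by_cases hpair : ({u, v} : Set V) = Set.univ
  · exact .inl (isSingleEdge_of_forall_eq_or_eq huv (Set.eq_univ_iff_forall.1 hpair))
  · obtain ⟨S, -, hS⟩ := (Set.toFinite {S : Set V | TwoLinked G S ∧ S.Nontrivial ∧
      S ≠ Set.univ}).exists_le_maximal ⟨twoLinked_pair huv, Set.nontrivial_pair huv.ne, hpair⟩
    exact .inr ⟨_, exists_isCycleGluing_of_maximal h.twoLinked hS ho⟩

end Decomposition

end CyclicOrientation

theorem theorem1 {V : Type*} [Finite V] (G : SimpleGraph V) :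
    (CyclicOrientation.CyclicallyOrientable G ↔
      ∀ B : G.Subgraph, CyclicOrientation.IsTwoConnectedComponent G B →
        CyclicOrientation.CyclicallyOrientable B.coe) ∧
    (CyclicOrientation.IsTwoConnected G →
      (CyclicOrientation.CyclicallyOrientable G ↔
        CyclicOrientation.IsCycleGraph G ∨ CyclicOrientation.IsSingleEdge G ∨
          ∃ G' C : G.Subgraph, CyclicOrientation.IsCycleGluing G G' C ∧
            CyclicOrientation.CyclicallyOrientable G'.coe)) ∧
    (∀ G' C : G.Subgraph, CyclicOrientation.IsCycleGluing G G' C →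
      (CyclicOrientation.CyclicallyOrientable G ↔
        CyclicOrientation.CyclicallyOrientable G'.coe)) := by
  refine ⟨⟨fun hG B hB => hG.coe hB.2.1,
      CyclicOrientation.cyclicallyOrientable_of_forall_isTwoConnectedComponent⟩,
    fun h2 => ⟨fun hG => .inr ?_, ?_⟩, fun G' C h => h.cyclicallyOrientable_iff⟩
  · rcases h2.isSingleEdge_or_exists_isCycleGluing hG with h | ⟨G', C, h⟩
    · exact .inl h
    · exact .inr ⟨G', C, h, h.cyclicallyOrientable_iff.1 hG⟩
  · rintro (h | h | ⟨G', C, h, hG'⟩)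
    · exact h.cyclicallyOrientable
    · exact h.cyclicallyOrientable
    · exact h.cyclicallyOrientable_iff.2 hG'
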